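/- Let $L$ be a finite bounded distributive lattice with at least two elements, regarded as an algebra $(L;\vee,\wedge,0,1)$. Let $ISP(L)$ be the category whose objects are the algebras isomorphic to a subalgebra of a direct power $L^I$ ($I$ any set, possibly empty), with all homomorphisms of bounded lattices. Let $PSpa$ be the category whose objects are the compact topological spaces $X$ with a partial order $\le$ such that whenever $x\not\le y$ there is a clopen up-set $W\subseteq X$ with $x\in W$ and $y\notin W$, with the continuous order-preserving maps. Then $ISP(L)$ is dually equivalent to $PSpa$, i.e. $ISP(L)^{\mathrm{op}}\simeq PSpa$. Moreover the dual equivalence is given by hom-functors into any two-element algebra $D\in ISP(L)$ (for example the subalgebra $\{0,1\}$ of $L$, or $L$ itself when $|L|=2$). Equip $D$, as an object of $PSpa$, with its order and the discrete topology. Let $\mathcal G(A)=\mathrm{Hom}_{ISP(L)}(A,D)$ with the pointwise order and the topology induced from the product space $D^A$, and let $\mathcal C(S)=\mathrm{Hom}_{PSpa}(S,D)$ with pointwise operations; both functors act on arrows by precomposition. Then the evaluation maps $\sigma_A:A\to\mathcal C\mathcal G(A)$, $\sigma_A(a)(v)=v(a)$, and $\delta_S:S\to\mathcal G\mathcal C(S)$,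 $\delta_S(s)(f)=f(s)$, are natural isomorphisms. -/

import Mathlib

open CategoryTheory

universe u

/-- `𝕀𝕊ℙ(L)`: the bounded distributive lattices isomorphic to a subalgebra (a sublattice containing
`⊥` and `⊤`) of a direct power `I → L`. The index set may be empty. An order isomorphism
between bounded lattices is the same as an isomorphism for the operations `∨, ∧, 0, 1`. -/
def MemISP (L : Type u) [DistribLattice L] [BoundedOrder L] : ObjectProperty BddDistLat.{u} :=
  fun A => ∃ (I : Type u) (S : Sublattice (I → L)),
    (⊥ : I → L) ∈ S ∧ (⊤ : I → L) ∈ S ∧ Nonempty (A ≃o S)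

/-- The category `ISP(L)`: algebras in `𝕀𝕊ℙ(L)` and all homomorphisms for `∨, ∧, 0, 1`. -/
abbrev ISP (L : Type u) [DistribLattice L] [BoundedOrder L] : Type (u + 1) :=
  (MemISP L).FullSubcategory

/-- An algebra that embeds into a power of `L` belongs to `𝕀𝕊ℙ(L)`. -/
theorem memISP_of_injective {L : Type u} [DistribLattice L] [BoundedOrder L] (A : BddDistLat.{u})
    (I : Type u) (f : BoundedLatticeHom A (I → L)) (hf : Function.Injective f) :
    MemISP L A := by
  have key : ∀ a b, f a ≤ f b ↔ a ≤ b := fun a b => by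
    rw [← inf_eq_left, ← map_inf, hf.eq_iff, inf_eq_left]
  refine ⟨I, ⟨Set.range f, ?_, ?_⟩, ⟨⊥, map_bot f⟩, ⟨⊤, map_top f⟩, ⟨?_⟩⟩
  · rintro _ ⟨a, rfl⟩ _ ⟨b, rfl⟩
    exact ⟨a ⊔ b, map_sup f a b⟩
  · rintro _ ⟨a, rfl⟩ _ ⟨b, rfl⟩
    exact ⟨a ⊓ b, map_inf f a b⟩
  · exact ⟨Equiv.ofInjective f hf, fun {a b} => key a b⟩

/-- Every algebra in `𝕀𝕊ℙ(L)` embeds into a power of `L`. -/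
theorem MemISP.exists_injective {L : Type u} [DistribLattice L] [BoundedOrder L]
    {A : BddDistLat.{u}} (hA : MemISP L A) :
    ∃ (I : Type u) (f : BoundedLatticeHom A (I → L)), Function.Injective f := by
  obtain ⟨I, S, hb, ht, ⟨e⟩⟩ := hA
  refine ⟨I, ⟨⟨⟨fun a => (e a : I → L), fun a b => ?_⟩, fun a b => ?_⟩, ?_, ?_⟩, ?_⟩
  · simp [map_sup]
  · simp [map_inf]
  · have h1 : e ⊤ = ⟨⊤, ht⟩ :=
      le_antisymm (fun _ => le_top) ((OrderIso.symm_apply_le e).1 le_top)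
    exact congrArg Subtype.val h1
  · have h0 : e ⊥ = ⟨⊥, hb⟩ :=
      le_antisymm ((OrderIso.le_symm_apply e).1 bot_le) (fun _ => bot_le)
    exact congrArg Subtype.val h0
  · exact fun a b h => e.injective (Subtype.ext h)

/-- An object of `PSpa`: a compact space with a partial order such that, whenever `¬ x ≤ y`, some
clopen up-set contains `x` but not `y`. -/
structure PSpa : Type (u + 1) where
  /-- The underlying set. -/
  carrier : Type u
  [top : TopologicalSpace carrier]
  [ord : PartialOrder carrier]
  [compact : CompactSpace carrier]
  [sep : PriestleySpace carrier]

namespace PSpa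

instance : CoeSort PSpa.{u} (Type u) := ⟨PSpa.carrier⟩

attribute [instance] PSpa.top PSpa.ord PSpa.compact PSpa.sep

/-- Arrows of `PSpa` are the continuous order-preserving maps. -/
instance : Category PSpa.{u} where
  Hom X Y := X →Co Y
  id X := ContinuousOrderHom.id X
  comp f g := ContinuousOrderHom.comp g f

instance : ConcreteCategory PSpa.{u} (fun X Y => X →Co Y) where
  hom f := f
  ofHom f := f

/-- A finite partially ordered set with the discrete topology, as an object of `PSpa`. -/
def discrete (D : Type u) [PartialOrder D] [Finite D] : PSpa.{u} :=
  letI : TopologicalSpace D := ⊥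
  haveI : DiscreteTopology D := ⟨rfl⟩
  { carrier := D
    sep := ⟨fun {x _} h => ⟨Set.Ici x, isClopen_discrete _, isUpperSet_Ici x, le_rfl, h⟩⟩ }

end PSpa

variable {L : Type u} [DistribLattice L] [BoundedOrder L]

/-- The set `HOM(A, D)` of homomorphisms, written as a type of its own to carry a topology and an
order. -/
def HomSpace (A D : ISP L) : Type u := A ⟶ D

namespace HomSpace

variable {A D : ISP L}

/-- The value `v(a)`. -/
def eval (v : HomSpace A D) (a : A.obj) : D.obj := InducedCategory.Hom.hom v a

theorem eval_injective : Function.Injective (eval : HomSpace A D → A.obj → D.obj) := by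
  intro v w h
  apply ObjectProperty.hom_ext
  ext a
  exact congrFun h a

/-- The pointwise order: `v ≤ w` iff `v(a) ≤ w(a)` for all `a`. -/
instance : PartialOrder (HomSpace A D) := PartialOrder.lift eval eval_injective

/-- The topology induced by the product topology on `A → D`, where `D` is discrete. -/
instance : TopologicalSpace (HomSpace A D) :=
  TopologicalSpace.induced eval (@Pi.topologicalSpace A.obj (fun _ => D.obj) (fun _ => ⊥))

theorem isClopen_eval (a : A.obj) (T : Set D.obj) :
    IsClopen {v : HomSpace A D | v.eval a ∈ T} := by
  letI : TopologicalSpace D.obj := ⊥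
  haveI : DiscreteTopology D.obj := ⟨rfl⟩
  have hc : Continuous fun v : HomSpace A D => v.eval a :=
    (continuous_apply a).comp continuous_induced_dom
  exact (isClopen_discrete T).preimage hc

instance : PriestleySpace (HomSpace A D) where
  priestley {v w} h := by
    have h' : ¬ ∀ a, v.eval a ≤ w.eval a := h
    push Not at h'
    obtain ⟨a, ha⟩ := h'
    exact ⟨_, isClopen_eval a (Set.Ici (v.eval a)), fun x y hxy hx => le_trans hx (hxy a),
      le_rfl, ha⟩

instance [Finite D.obj] : CompactSpace (HomSpace A D) := by
  letI : TopologicalSpace D.obj := ⊥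
  haveI : DiscreteTopology D.obj := ⟨rfl⟩
  have hemb : Topology.IsInducing (eval : HomSpace A D → A.obj → D.obj) := ⟨rfl⟩
  have hc (a : A.obj) : Continuous fun f : A.obj → D.obj => f a := continuous_apply a
  have hr : Set.range (eval : HomSpace A D → A.obj → D.obj) =
      {f | (∀ a b, f (a ⊔ b) = f a ⊔ f b) ∧ (∀ a b, f (a ⊓ b) = f a ⊓ f b) ∧
        f ⊤ = ⊤ ∧ f ⊥ = ⊥} := by
    ext f
    constructor
    · rintro ⟨v, rfl⟩
      exact ⟨map_sup (InducedCategory.Hom.hom v).hom, map_inf (InducedCategory.Hom.hom v).hom,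
        map_top (InducedCategory.Hom.hom v).hom, map_bot (InducedCategory.Hom.hom v).hom⟩
    · rintro ⟨h1, h2, h3, h4⟩
      exact ⟨ObjectProperty.homMk (BddDistLat.ofHom ⟨⟨⟨f, h1⟩, h2⟩, h3, h4⟩), rfl⟩
  have hcl : IsClosed (Set.range (eval : HomSpace A D → A.obj → D.obj)) := by
    rw [hr]
    have h2 (g : D.obj × D.obj → D.obj) : Continuous g := continuous_of_discreteTopology
    simp only [Set.ofPred_and, Set.ofPred_forall]
    refine (isClosed_iInter fun a => isClosed_iInter fun b => ?_).inter
      ((isClosed_iInter fun a => isClosed_iInter fun b => ?_).inter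
        ((isClosed_eq (hc _) continuous_const).inter (isClosed_eq (hc _) continuous_const)))
    · exact isClosed_eq (hc _) ((h2 fun p => p.1 ⊔ p.2).comp ((hc a).prodMk (hc b)))
    · exact isClosed_eq (hc _) ((h2 fun p => p.1 ⊓ p.2).comp ((hc a).prodMk (hc b)))
  exact (Topology.IsClosedEmbedding.mk ⟨hemb, eval_injective⟩ hcl).compactSpace

/-- Precomposition with a homomorphism `f : A → B`, as a map `HOM(B, D) → HOM(A, D)`. -/
def precomp {A B : ISP L} (f : A ⟶ B) : HomSpace B D →Co HomSpace A D where
  toFun v := f ≫ v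
  monotone' _ _ h a := h (InducedCategory.Hom.hom f a)
  continuous_toFun := by
    letI : TopologicalSpace D.obj := ⊥
    refine continuous_induced_rng.2 (continuous_pi fun a => ?_)
    exact (continuous_apply (InducedCategory.Hom.hom f a)).comp continuous_induced_dom

end HomSpace

/-- The contravariant functor `HOM(-, D)` from `ISP(L)` to `PSpa`, for a finite algebra `D`: an
algebra `A` goes to the ordered space `HOM(A, D)`, a homomorphism `f` to `v ↦ v ∘ f`. -/
def homFunctor (D : ISP L) [Finite D.obj] : (ISP L)ᵒᵖ ⥤ PSpa.{u} where
  obj A := { carrier := HomSpace A.unop D }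
  map f := HomSpace.precomp f.unop

/-- The set `HOM(S, D)` of arrows of `PSpa` into the discrete ordered space `D`, written as a type
of its own to carry the pointwise operations. -/
def MapAlg (S : PSpa.{u}) (D : ISP L) [Finite D.obj] : Type u := S ⟶ PSpa.discrete D.obj

namespace MapAlg

variable {S : PSpa.{u}} {D : ISP L} [Finite D.obj]

/-- The value `f(s)`. -/
def eval (f : MapAlg S D) (s : S) : D.obj := DFunLike.coe (F := S →Co PSpa.discrete D.obj) f s

theorem eval_injective : Function.Injective (eval : MapAlg S D → S → D.obj) := by
  intro f g h
  exact ContinuousOrderHom.ext fun s => congrFun h s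

/-- The element of `HOM(S, D)` with the given values. -/
def mk (f : S → D.obj) (hf : Monotone f) (hc : ∀ T : Set D.obj, IsOpen (f ⁻¹' T)) : MapAlg S D :=
  letI : TopologicalSpace D.obj := ⊥
  (⟨⟨f, hf⟩, ⟨fun T _ => hc T⟩⟩ : S →Co D.obj)

theorem monotone_eval (f : MapAlg S D) : Monotone f.eval :=
  OrderHom.monotone' (ContinuousOrderHom.toOrderHom (β := PSpa.discrete D.obj) f)

theorem isOpen_preimage (f : MapAlg S D) (T : Set D.obj) : IsOpen (f.eval ⁻¹' T) := by
  let _ : TopologicalSpace D.obj := ⊥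
  have _ : DiscreteTopology D.obj := ⟨rfl⟩
  exact (isOpen_discrete T).preimage (ContinuousOrderHom.continuous_toFun (β := PSpa.discrete D.obj) f)

theorem isOpen_preimage₂ (f g : MapAlg S D) (m : D.obj → D.obj → D.obj) (T : Set D.obj) :
    IsOpen ((fun s => m (f.eval s) (g.eval s)) ⁻¹' T) := by
  have h : (fun s => m (f.eval s) (g.eval s)) ⁻¹' T =
      ⋃ p : {p : D.obj × D.obj // m p.1 p.2 ∈ T}, f.eval ⁻¹' {p.1.1} ∩ g.eval ⁻¹' {p.1.2} := by
    ext s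
    simp
  rw [h]
  exact isOpen_iUnion fun p => (f.isOpen_preimage _).inter (g.isOpen_preimage _)

/-- The operations `∨, ∧, 0, 1` and the order on `HOM(S, D)` are pointwise. -/
instance : Max (MapAlg S D) where
  max f g := mk (fun s => f.eval s ⊔ g.eval s) (f.monotone_eval.sup g.monotone_eval)
    (isOpen_preimage₂ f g (· ⊔ ·))

instance : Min (MapAlg S D) where
  min f g := mk (fun s => f.eval s ⊓ g.eval s) (f.monotone_eval.inf g.monotone_eval)
    (isOpen_preimage₂ f g (· ⊓ ·))

instance : PartialOrder (MapAlg S D) := PartialOrder.lift eval eval_injective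

instance : DistribLattice (MapAlg S D) :=
  eval_injective.distribLattice eval Iff.rfl Iff.rfl (fun _ _ => rfl) (fun _ _ => rfl)

instance : BoundedOrder (MapAlg S D) where
  top := mk (fun _ => ⊤) (fun _ _ _ => le_rfl) (fun _ => isOpen_const)
  bot := mk (fun _ => ⊥) (fun _ _ _ => le_rfl) (fun _ => isOpen_const)
  le_top _ _ := le_top
  bot_le _ _ := bot_le

theorem memISP (S : PSpa.{u}) (D : ISP L) [Finite D.obj] :
    MemISP L (BddDistLat.of (MapAlg S D)) := by
  obtain ⟨I, f, hf⟩ := D.property.exists_injective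
  refine memISP_of_injective _ (S × I)
    ⟨⟨⟨fun φ p => f (φ.eval p.1) p.2, fun φ ψ => ?_⟩, fun φ ψ => ?_⟩, ?_, ?_⟩ ?_
  · funext p
    exact congrFun (map_sup f _ _) p.2
  · funext p
    exact congrFun (map_inf f _ _) p.2
  · funext p
    exact congrFun (map_top f) p.2
  · funext p
    exact congrFun (map_bot f) p.2
  · intro φ ψ h
    refine eval_injective (funext fun s => hf (funext fun i => ?_))
    exact congrFun h (s, i)

/-- Precomposition with an arrow `g : S → T`, as a homomorphism `HOM(T, D) → HOM(S, D)`. -/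
def precomp {S T : PSpa.{u}} (g : S ⟶ T) : BoundedLatticeHom (MapAlg T D) (MapAlg S D) where
  toFun f := g ≫ f
  map_sup' _ _ := rfl
  map_inf' _ _ := rfl
  map_top' := rfl
  map_bot' := rfl

end MapAlg

/-- The contravariant functor `HOM(-, D)` from `PSpa` to `ISP(L)`, for a finite algebra `D`: a
space `S` goes to the algebra `HOM(S, D)`, an arrow `g` to `f ↦ f ∘ g`. -/
def mapFunctor (D : ISP L) [Finite D.obj] : PSpa.{u}ᵒᵖ ⥤ ISP L where
  obj S := ⟨BddDistLat.of (MapAlg S.unop D), MapAlg.memISP S.unop D⟩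
  map g := ObjectProperty.homMk (BddDistLat.ofHom (MapAlg.precomp g.unop))

/-- The evaluation homomorphism `A → HOM(HOM(A, D), D)`, `a ↦ (v ↦ v(a))`. -/
def evalAlg (D : ISP L) [Finite D.obj] (A : ISP L) :
    A ⟶ (mapFunctor D).obj (.op ((homFunctor D).obj (.op A))) :=
  ObjectProperty.homMk (BddDistLat.ofHom
    (X := A.obj) (Y := MapAlg ((homFunctor D).obj (.op A)) D)
    { toFun a := MapAlg.mk (S := (homFunctor D).obj (.op A)) (fun v => HomSpace.eval v a)
        (fun _ _ h => h a) (fun T => (HomSpace.isClopen_eval a T).isOpen)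
      map_sup' a b := MapAlg.eval_injective
        (funext fun v => map_sup (InducedCategory.Hom.hom v).hom a b)
      map_inf' a b := MapAlg.eval_injective
        (funext fun v => map_inf (InducedCategory.Hom.hom v).hom a b)
      map_top' := MapAlg.eval_injective (funext fun v => map_top (InducedCategory.Hom.hom v).hom)
      map_bot' := MapAlg.eval_injective (funext fun v => map_bot (InducedCategory.Hom.hom v).hom) })

/-- The evaluation arrow `S → HOM(HOM(S, D), D)`, `s ↦ (f ↦ f(s))`. -/
def evalSpace (D : ISP L) [Finite D.obj] (S : PSpa.{u}) :
    S ⟶ (homFunctor D).obj (.op ((mapFunctor D).obj (.op S))) :=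
  ({ toFun s := (ObjectProperty.homMk (BddDistLat.ofHom (X := MapAlg S D) (Y := D.obj)
        { toFun f := f.eval s
          map_sup' _ _ := rfl
          map_inf' _ _ := rfl
          map_top' := rfl
          map_bot' := rfl }) : (mapFunctor D).obj (.op S) ⟶ D)
     monotone' _ _ h f := MapAlg.monotone_eval (S := S) (D := D) f h
     continuous_toFun := by
       let _ : TopologicalSpace D.obj := ⊥
       refine continuous_induced_rng.2 (continuous_pi fun f => ?_)
       exact ContinuousOrderHom.continuous_toFun (β := PSpa.discrete D.obj) f } :
    S →Co HomSpace ((mapFunctor D).obj (.op S)) D)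

/-!
Homomorphisms into a two-element lattice separate the points of every bounded distributive lattice,
by the prime ideal theorem, so for nontrivial `L` every bounded distributive lattice lies in
`𝕀𝕊ℙ(L)`, and the claim is Priestley duality. Since `D` has only the elements `⊥` and `⊤`, an arrow
`S → D` is the indicator of a clopen up-set of `S`, and `HOM(S, D)` is the lattice of clopen up-sets
of `S`. The surjectivity of the two evaluation maps then comes from compactness: a sublattice of
clopen up-sets which separates points consists of all of them, and a homomorphism from the clopen
up-sets to `D` is given by membership of a point.
-/

section TwoElement

variable {D : Type*} [PartialOrder D] [BoundedOrder D]

theorem isSimpleOrder_of_natCard_eq_two (hD : Nat.card D = 2) : IsSimpleOrder D := by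
  have : Finite D := Nat.finite_of_card_ne_zero (by omega)
  have : Nontrivial D := Finite.one_lt_card_iff_nontrivial.1 (by omega)
  refine .of_forall_eq_top fun x hx => ?_
  have hpair : ({⊥, ⊤} : Set D) = Set.univ :=
    Set.eq_of_subset_of_ncard_le (Set.subset_univ _)
      (by rw [Set.ncard_univ, hD, Set.ncard_pair bot_ne_top])
  exact (hpair.ge (Set.mem_univ x)).resolve_left hx

variable [IsSimpleOrder D] {x y : D}

theorem le_iff_eq_top_imp_eq_top : x ≤ y ↔ (x = ⊤ → y = ⊤) := by
  rcases eq_bot_or_eq_top x with rfl | rfl <;> simp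

theorem eq_iff_eq_top_iff_eq_top : x = y ↔ (x = ⊤ ↔ y = ⊤) := by
  rw [le_antisymm_iff, le_iff_eq_top_imp_eq_top, le_iff_eq_top_imp_eq_top]
  exact iff_def.symm

end TwoElement

section PrimeIdeal

open Classical in
/-- The homomorphism onto `{⊥, ⊤}` with kernel a given prime ideal `J`: it is `⊥` on `J` and `⊤`
off `J`. -/
noncomputable def boundedLatticeHomOfPrimeIdeal (D : Type*) [Lattice D] [BoundedOrder D]
    {A : Type*} [Lattice A] [BoundedOrder A] {J : Order.Ideal A} (hJ : J.IsPrime) :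
    BoundedLatticeHom A D where
  toFun a := if a ∈ J then ⊥ else ⊤
  map_sup' a b := by
    by_cases ha : a ∈ J <;> by_cases hb : b ∈ J <;> simp [Order.Ideal.sup_mem_iff, ha, hb]
  map_inf' a b := by
    have mem_inf_iff : a ⊓ b ∈ J ↔ a ∈ J ∨ b ∈ J :=
      ⟨hJ.mem_or_mem, Or.rec (J.lower inf_le_left) (J.lower inf_le_right)⟩
    by_cases ha : a ∈ J <;> by_cases hb : b ∈ J <;> simp [mem_inf_iff, ha, hb]
  map_top' := if_neg hJ.toIsProper.top_notMem
  map_bot' := if_pos J.bot_mem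

variable {A : Type*} [DistribLattice A]

theorem exists_isPrime_mem_notMem_of_not_le {a b : A} (hab : ¬ a ≤ b) :
    ∃ J : Order.Ideal A, J.IsPrime ∧ b ∈ J ∧ a ∉ J := by
  have hdisj : Disjoint (Order.PFilter.principal a : Set A) (Order.Ideal.principal b : Set A) :=
    Set.disjoint_left.2 fun _ hax hxb => hab
      ((Order.PFilter.mem_principal.1 hax).trans (Order.Ideal.mem_principal.1 hxb))
  obtain ⟨J, hJ, hbJ, haJ⟩ := DistribLattice.prime_ideal_of_disjoint_filter_ideal hdisj
  exact ⟨J, hJ, hbJ (Order.Ideal.mem_principal.2 le_rfl),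
    Set.disjoint_left.1 haJ (Order.PFilter.mem_principal.2 le_rfl)⟩

variable [BoundedOrder A]

theorem le_of_forall_boundedLatticeHom_apply_le (D : Type*) [Lattice D] [BoundedOrder D]
    [Nontrivial D] {a b : A} (h : ∀ v : BoundedLatticeHom A D, v a ≤ v b) : a ≤ b := by
  by_contra hab
  obtain ⟨J, hJ, hb, ha⟩ := exists_isPrime_mem_notMem_of_not_le hab
  have hle : (⊤ : D) ≤ ⊥ :=
    calc ⊤ = boundedLatticeHomOfPrimeIdeal D hJ a := (if_neg ha).symm
      _ ≤ boundedLatticeHomOfPrimeIdeal D hJ b := h _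
      _ = ⊥ := if_pos hb
  exact top_ne_bot (le_bot_iff.1 hle)

theorem eq_of_forall_boundedLatticeHom_apply_eq (D : Type*) [Lattice D] [BoundedOrder D]
    [Nontrivial D] {a b : A} (h : ∀ v : BoundedLatticeHom A D, v a = v b) : a = b :=
  le_antisymm (le_of_forall_boundedLatticeHom_apply_le D fun v => (h v).le)
    (le_of_forall_boundedLatticeHom_apply_le D fun v => (h v).ge)

end PrimeIdeal

theorem memISP_of_nontrivial (L : Type u) [DistribLattice L] [BoundedOrder L] [Nontrivial L]
    (A : BddDistLat.{u}) : MemISP L A :=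
  memISP_of_injective A (BoundedLatticeHom A L)
    { toFun a v := v a
      map_sup' a b := funext fun v => map_sup v a b
      map_inf' a b := funext fun v => map_inf v a b
      map_top' := funext fun v => map_top v
      map_bot' := funext fun v => map_bot v }
    fun _ _ h => eq_of_forall_boundedLatticeHom_apply_eq L (congrFun h)

section ClopenUpperSet

variable {X : Type*} [TopologicalSpace X] [CompactSpace X]

section Separation

variable [Preorder X] {A : Type*} [Lattice A] [BoundedOrder A]
  {φ : BoundedLatticeHom A (ClopenUpperSet X)}

theorem exists_mem_apply_le_of_separates (hφ : ∀ x y, ¬ x ≤ y → ∃ a, x ∈ φ a ∧ y ∉ φ a)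
    {U : ClopenUpperSet X} {x : X} (hx : x ∈ U) : ∃ a, x ∈ φ a ∧ φ a ≤ U := by
  suffices h : ∃ a, x ∈ φ a ∧ Disjoint (U : Set X)ᶜ (φ a) by
    simpa only [Set.disjoint_compl_left_iff_subset, SetLike.coe_subset_coe] using h
  refine U.isClopen.compl.isClosed.isCompact.induction_on
    (p := fun K => ∃ a, x ∈ φ a ∧ Disjoint K (φ a)) ⟨⊤, ?_, ?_⟩ ?_ ?_ ?_
  · rw [map_top]
    trivial
  · exact Set.empty_disjoint _
  · rintro K K' hK ⟨a, hxa, ha⟩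
    exact ⟨a, hxa, ha.mono_left hK⟩
  · rintro K K' ⟨a, hxa, ha⟩ ⟨b, hxb, hb⟩
    refine ⟨a ⊓ b, ?_, ?_⟩ <;> rw [map_inf]
    · exact ⟨hxa, hxb⟩
    · exact (ha.mono_right Set.inter_subset_left).union_left
        (hb.mono_right Set.inter_subset_right)
  · intro y hy
    obtain ⟨a, hxa, hya⟩ := hφ x y fun hxy => hy (U.upper hxy hx)
    exact ⟨(φ a : Set X)ᶜ, mem_nhdsWithin_of_mem_nhds ((φ a).isClopen.compl.isOpen.mem_nhds hya),
      a, hxa, disjoint_compl_left⟩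

theorem surjective_of_separates (hφ : ∀ x y, ¬ x ≤ y → ∃ a, x ∈ φ a ∧ y ∉ φ a) :
    Function.Surjective φ := by
  intro U
  suffices h : ∃ a, (U : Set X) ⊆ φ a ∧ φ a ≤ U from
    h.imp fun a ha => le_antisymm ha.2 ha.1
  refine U.isClopen.isClosed.isCompact.induction_on
    (p := fun K => ∃ a, K ⊆ φ a ∧ φ a ≤ U) ⟨⊥, Set.empty_subset _, ?_⟩ ?_ ?_ ?_
  · rw [map_bot]
    exact bot_le
  · rintro K K' hK ⟨a, hKa, ha⟩
    exact ⟨a, hK.trans hKa, ha⟩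
  · rintro K K' ⟨a, hKa, ha⟩ ⟨b, hKb, hb⟩
    refine ⟨a ⊔ b, ?_, ?_⟩ <;> rw [map_sup]
    · exact Set.union_subset_union hKa hKb
    · exact sup_le ha hb
  · intro x hx
    obtain ⟨a, hxa, ha⟩ := exists_mem_apply_le_of_separates hφ hx
    exact ⟨φ a, mem_nhdsWithin_of_mem_nhds ((φ a).isClopen.isOpen.mem_nhds hxa), a, subset_rfl, ha⟩

end Separation

theorem exists_forall_mem_iff_apply_eq_top [LE X] {D : Type*} [Lattice D] [BoundedOrder D]
    [IsSimpleOrder D] (v : BoundedLatticeHom (ClopenUpperSet X) D) :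
    ∃ x : X, ∀ W, x ∈ W ↔ v W = ⊤ := by
  by_contra! hv
  obtain ⟨W, V, hW, hV, hWV⟩ : ∃ W V : ClopenUpperSet X, v W = ⊤ ∧ v V = ⊥ ∧
      Set.univ ∩ (W : Set X) ⊆ V := by
    refine isCompact_univ.induction_on
      (p := fun K => ∃ W V : ClopenUpperSet X, v W = ⊤ ∧ v V = ⊥ ∧ K ∩ (W : Set X) ⊆ V)
      ⟨⊤, ⊥, map_top v, map_bot v, by simp⟩ ?_ ?_ ?_
    · rintro K K' hK ⟨W, V, hW, hV, hWV⟩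
      exact ⟨W, V, hW, hV, (Set.inter_subset_inter_left _ hK).trans hWV⟩
    · rintro K K' ⟨W, V, hW, hV, hWV⟩ ⟨W', V', hW', hV', hWV'⟩
      refine ⟨W ⊓ W', V ⊔ V', by simp [hW, hW'], by simp [hV, hV'], ?_⟩
      rintro x ⟨hx | hx, hxW, hxW'⟩
      exacts [Or.inl (hWV ⟨hx, hxW⟩), Or.inr (hWV' ⟨hx, hxW'⟩)]
    · intro x _
      obtain ⟨W, ⟨hx, hW⟩ | ⟨hx, hW⟩⟩ := hv x
      · exact ⟨W, mem_nhdsWithin_of_mem_nhds (W.isClopen.isOpen.mem_nhds hx), ⊤, W, map_top v,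
          (eq_bot_or_eq_top _).resolve_right hW, Set.inter_subset_left⟩
      · exact ⟨(W : Set X)ᶜ, mem_nhdsWithin_of_mem_nhds (W.isClopen.compl.isOpen.mem_nhds hx),
          W, ⊥, hW, map_bot v, (Set.compl_inter_self _).subset⟩
  have hle : v W ≤ v V := OrderHomClass.mono v (by simpa using hWV)
  rw [hW, hV] at hle
  exact top_ne_bot (le_bot_iff.1 hle)

end ClopenUpperSet

instance bddDistLat_forget_reflectsIsomorphisms : (forget BddDistLat.{u}).ReflectsIsomorphisms where
  reflects f hf :=
    have hbij : Function.Bijective f := (isIso_iff_bijective _).1 hf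
    let e := OrderIso.ofSurjective (orderEmbeddingOfInjective f.hom hbij.injective) hbij.surjective
    (BddDistLat.Iso.mk e).isIso_hom

theorem ISP.isIso_of_bijective {A B : ISP L} (f : A ⟶ B) (hf : Function.Bijective f.hom) :
    IsIso f :=
  have : IsIso ((forget BddDistLat).map ((MemISP L).ι.map f)) := (isIso_iff_bijective _).2 hf
  have : IsIso ((MemISP L).ι.map f) := isIso_of_reflects_iso _ (forget BddDistLat)
  isIso_of_fully_faithful (MemISP L).ι f

theorem PSpa.isIso_of_surjective_of_reflects_le {S T : PSpa.{u}} (f : S ⟶ T)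
    (hsurj : Function.Surjective f) (hle : ∀ s t, f s ≤ f t → s ≤ t) : IsIso f := by
  have hinj : Function.Injective f := fun s t h => le_antisymm (hle s t h.le) (hle t s h.ge)
  let e : S ≃ T := Equiv.ofBijective f ⟨hinj, hsurj⟩
  have he : Continuous e := ContinuousOrderHom.continuous_toFun f
  let g : T →Co S :=
    { toFun := e.symm
      monotone' x y hxy := hle _ _ <|
        ((e.apply_symm_apply x).trans_le hxy).trans_eq (e.apply_symm_apply y).symm
      continuous_toFun := he.continuous_symm_of_equiv_compact_to_t2 }
  exact ⟨g, ContinuousOrderHom.ext e.symm_apply_apply, ContinuousOrderHom.ext e.apply_symm_apply⟩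

namespace MapAlg

variable {S : PSpa.{u}} {D : ISP L}

section Finite

variable [Finite D.obj]

open Classical in
/-- The indicator of a clopen up-set, with values `⊤` and `⊥`, as an element of `HOM(S, D)`. -/
noncomputable def indicator (D : ISP L) [Finite D.obj] (W : ClopenUpperSet S) : MapAlg S D :=
  mk ((W : Set S).piecewise (fun _ => ⊤) (fun _ => ⊥))
    (fun x y hxy => by
      by_cases hx : x ∈ W
      · simp [hx, W.upper hxy hx]
      · simp [hx])
    (fun T => by
      let _ : TopologicalSpace D.obj := ⊥
      have : DiscreteTopology D.obj := ⟨rfl⟩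
      refine (isOpen_discrete T).preimage
        (Continuous.piecewise ?_ continuous_const continuous_const)
      simp [W.isClopen.frontier_eq])

theorem eval_indicator_of_mem {W : ClopenUpperSet S} {s : S} (hs : s ∈ W) :
    (indicator D W).eval s = ⊤ :=
  if_pos hs

theorem eval_indicator_of_notMem {W : ClopenUpperSet S} {s : S} (hs : s ∉ W) :
    (indicator D W).eval s = ⊥ :=
  if_neg hs

theorem le_of_forall_eval_le (D : ISP L) [Finite D.obj] [Nontrivial D.obj] {s t : S}
    (h : ∀ f : MapAlg S D, f.eval s ≤ f.eval t) : s ≤ t := by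
  by_contra hst
  obtain ⟨U, hU, hup, hs, ht⟩ := exists_isClopen_upper_of_not_le hst
  let W : ClopenUpperSet S := ⟨⟨U, hU⟩, hup⟩
  have hle : (⊤ : D.obj) ≤ ⊥ :=
    calc ⊤ = (indicator D W).eval s := (eval_indicator_of_mem hs).symm
      _ ≤ (indicator D W).eval t := h _
      _ = ⊥ := eval_indicator_of_notMem ht
  exact top_ne_bot (le_bot_iff.1 hle)

/-- The clopen up-set `{s | f(s) = ⊤}`. -/
def preimageTop (f : MapAlg S D) : ClopenUpperSet S where
  carrier := f.eval ⁻¹' {⊤}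
  isClopen' := ⟨⟨f.isOpen_preimage {⊤}ᶜ⟩, f.isOpen_preimage {⊤}⟩
  upper' _ _ hst hs := top_le_iff.1 (hs.symm.trans_le (f.monotone_eval hst))

end Finite

open scoped IsSimpleOrder

variable [IsSimpleOrder D.obj]

/-- For a two-element `D`, the algebra `HOM(S, D)` is the lattice of clopen up-sets of `S`. -/
noncomputable def orderIsoClopenUpperSet (S : PSpa.{u}) (D : ISP L) [IsSimpleOrder D.obj] :
    MapAlg S D ≃o ClopenUpperSet S where
  toFun := preimageTop
  invFun := indicator D
  left_inv f := eval_injective <| funext fun s => by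
    by_cases hs : f.eval s = ⊤
    · exact (eval_indicator_of_mem hs).trans hs.symm
    · exact (eval_indicator_of_notMem hs).trans ((eq_bot_or_eq_top _).resolve_right hs).symm
  right_inv W := ClopenUpperSet.ext <| Set.ext fun s => by
    by_cases hs : s ∈ W
    · exact iff_of_true (eval_indicator_of_mem hs) hs
    · exact iff_of_false (fun h => bot_ne_top ((eval_indicator_of_notMem hs).symm.trans h)) hs
  map_rel_iff' {_ _} := forall_congr' fun _ => le_iff_eq_top_imp_eq_top.symm

theorem mem_orderIsoClopenUpperSet_iff {f : MapAlg S D} {s : S} :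
    s ∈ orderIsoClopenUpperSet S D f ↔ f.eval s = ⊤ :=
  Iff.rfl

theorem exists_forall_eval_eq (v : BoundedLatticeHom (MapAlg S D) D.obj) :
    ∃ s : S, ∀ f : MapAlg S D, f.eval s = v f := by
  let e := orderIsoClopenUpperSet S D
  obtain ⟨s, hs⟩ := exists_forall_mem_iff_apply_eq_top
    (v.comp (e.symm : BoundedLatticeHom (ClopenUpperSet S) (MapAlg S D)))
  refine ⟨s, fun f => eq_iff_eq_top_iff_eq_top.2 ?_⟩
  calc f.eval s = ⊤ ↔ s ∈ e f := mem_orderIsoClopenUpperSet_iff.symm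
    _ ↔ v (e.symm (e f)) = ⊤ := hs (e f)
    _ ↔ v f = ⊤ := by rw [e.symm_apply_apply]

end MapAlg

section Duality

open scoped IsSimpleOrder

variable (D : ISP L) [IsSimpleOrder D.obj]

theorem evalAlg_injective (A : ISP L) : Function.Injective (evalAlg D A).hom := by
  intro a b h
  refine eq_of_forall_boundedLatticeHom_apply_eq D.obj fun v => ?_
  let w : HomSpace A D := ObjectProperty.homMk (BddDistLat.ofHom v)
  exact congrArg (MapAlg.eval (S := (homFunctor D).obj (.op A)) · w) h

theorem evalAlg_surjective (A : ISP L) : Function.Surjective (evalAlg D A).hom := by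
  let S := (homFunctor D).obj (.op A)
  let e := MapAlg.orderIsoClopenUpperSet S D
  let φ : BoundedLatticeHom A.obj (ClopenUpperSet S) :=
    (e : BoundedLatticeHom (MapAlg S D) (ClopenUpperSet S)).comp (evalAlg D A).hom.hom
  have hφ : Function.Surjective φ := by
    refine surjective_of_separates fun (v w : HomSpace A D) hvw => ?_
    obtain ⟨a, ha⟩ : ∃ a, ¬ v.eval a ≤ w.eval a := not_forall.1 hvw
    exact ⟨a, Classical.not_imp.1 (mt le_iff_eq_top_imp_eq_top.2 ha)⟩
  exact (Function.Surjective.of_comp_iff' e.bijective _).1 hφ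

instance isIso_evalAlg (A : ISP L) : IsIso (evalAlg D A) :=
  ISP.isIso_of_bijective _ ⟨evalAlg_injective D A, evalAlg_surjective D A⟩

theorem evalSpace_surjective (S : PSpa.{u}) : Function.Surjective (evalSpace D S) := by
  intro v
  obtain ⟨s, hs⟩ := MapAlg.exists_forall_eval_eq v.hom.hom
  exact ⟨s, HomSpace.eval_injective (funext hs)⟩

instance isIso_evalSpace (S : PSpa.{u}) : IsIso (evalSpace D S) :=
  PSpa.isIso_of_surjective_of_reflects_le _ (evalSpace_surjective D S)
    fun _ _ => MapAlg.le_of_forall_eval_le D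

/-- The evaluation maps `A → HOM(HOM(A, D), D)` as a natural isomorphism. -/
noncomputable def evalAlgNatIso : 𝟭 (ISP L) ≅ (homFunctor D).rightOp ⋙ mapFunctor D :=
  NatIso.ofComponents (fun A => (asIso (evalAlg D A) :)) fun _ => rfl

/-- The evaluation maps `S → HOM(HOM(S, D), D)` as a natural isomorphism. -/
noncomputable def evalSpaceNatIso : 𝟭 PSpa.{u} ≅ (mapFunctor D).rightOp ⋙ homFunctor D :=
  NatIso.ofComponents (fun S => (asIso (evalSpace D S) :)) fun _ => rfl

/-- The dual equivalence between `ISP(L)` and `PSpa` given by the two functors `HOM(-, D)`. -/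
noncomputable def homEquivalence : (ISP L)ᵒᵖ ≌ PSpa.{u} :=
  .mk (homFunctor D) (mapFunctor D).rightOp (NatIso.op (evalAlgNatIso D)).symm
    (evalSpaceNatIso D).symm

end Duality

theorem theoremD12_general (L : Type u) [DistribLattice L] [BoundedOrder L] [Nontrivial L] :
    Nonempty ((ISP L)ᵒᵖ ≌ PSpa.{u}) ∧
    ∀ (D : ISP L) [Finite D.obj], Nat.card D.obj = 2 →
      ∃ (σ : 𝟭 (ISP L) ≅ (homFunctor D).rightOp ⋙ mapFunctor D)
        (δ : 𝟭 PSpa.{u} ≅ (mapFunctor D).rightOp ⋙ homFunctor D),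
        (∀ A : ISP L, σ.hom.app A = evalAlg D A) ∧
        (∀ S : PSpa.{u}, δ.hom.app S = evalSpace D S) := by
  constructor
  · let D : ISP L := ⟨.of (ULift.{u} Bool), memISP_of_nontrivial L _⟩
    have : IsSimpleOrder D.obj := ULift.orderIso.isSimpleOrder
    exact ⟨homEquivalence D⟩
  · intro D _ hD
    have := isSimpleOrder_of_natCard_eq_two hD
    exact ⟨evalAlgNatIso D, evalSpaceNatIso D, fun _ => rfl, fun _ => rfl⟩

theorem theoremD12 (L : Type u) [DistribLattice L] [BoundedOrder L] [Finite L] [Nontrivial L] :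
    Nonempty ((ISP L)ᵒᵖ ≌ PSpa.{u}) ∧
    ∀ (D : ISP L) [Finite D.obj], Nat.card D.obj = 2 →
      ∃ (σ : 𝟭 (ISP L) ≅ (homFunctor D).rightOp ⋙ mapFunctor D)
        (δ : 𝟭 PSpa.{u} ≅ (mapFunctor D).rightOp ⋙ homFunctor D),
        (∀ A : ISP L, σ.hom.app A = evalAlg D A) ∧
        (∀ S : PSpa.{u}, δ.hom.app S = evalSpace D S) :=
  theoremD12_general L
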